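/- Let $\Omega\subset\mathbb{R}^2$ be open and let $f\in C^1(\Omega,\mathbb{R})$. The following two conditions are equivalent: (i) $\partial_1 f(x,\cdot)$ is locally Lipschitz, locally uniformly with respect to $x$; that is, every point $(x_0,y_0)\in\Omega$ has a neighborhood $U\times V\subset\Omega$ and a constant $K\ge 0$ such that $|\partial_1 f(x,y)-\partial_1 f(x,y')|\le K|y-y'|$ for all $x\in U$ and $y,y'\in V$. (ii) $\partial_2 f(\cdot,y)$ is locally Lipschitz, locally uniformly with respect to $y$; that is, every point $(x_0,y_0)\in\Omega$ has a neighborhood $U\times V\subset\Omega$ and a constant $K\ge 0$ such that $|\partial_2 f(x,y)-\partial_2 f(x',y)|\le K|x-x'|$ for all $x,x'\in U$ and $y\in V$. Both conditions hold, for instance, if $f\in C^{1,1}_{\mathrm{loc}}(\Omega,\mathbb{R})$, i.e. if $f$ is $C^1$ and its differential $df$ is locally Lipschitz on $\Omega$. If they hold, then there is a set $E\subset\Omega$ with $|\Omega\setminus E|=0$ (Lebesgue measure) such that at every point of $E$ the function $f$ is differentiable, the mixed partial derivatives $\partial_2\partial_1 f$ and $\partial_1\partial_2 f$ both exist, and $\partial_2\partial_1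 f=\partial_1\partial_2 f$. Moreover, $\partial_2\partial_1 f$ and $\partial_1\partial_2 f$ (which are defined almost everywhere on $\Omega$) belong to $L^\infty_{\mathrm{loc}}(\Omega,\mathbb{R})$, i.e. to $L^\infty(C)$ for every compact $C\subset\Omega$. -/

import Mathlib

open Set Filter Topology MeasureTheory
open scoped NNReal ENNReal

noncomputable section

/-- The partial derivative `∂₁ f` with respect to the first coordinate. -/
def pderivFst (f : ℝ × ℝ → ℝ) (p : ℝ × ℝ) : ℝ := deriv (fun x => f (x, p.2)) p.1

/-- The partial derivative `∂₂ f` with respect to the second coordinate. -/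
def pderivSnd (f : ℝ × ℝ → ℝ) (p : ℝ × ℝ) : ℝ := deriv (fun y => f (p.1, y)) p.2

/-- `∂₁ f` exists (and is finite) at `p`. -/
def ExistsPderivFstAt (f : ℝ × ℝ → ℝ) (p : ℝ × ℝ) : Prop :=
  DifferentiableAt ℝ (fun x => f (x, p.2)) p.1

/-- `∂₂ f` exists (and is finite) at `p`. -/
def ExistsPderivSndAt (f : ℝ × ℝ → ℝ) (p : ℝ × ℝ) : Prop :=
  DifferentiableAt ℝ (fun y => f (p.1, y)) p.2

/-- On `Ω`, the functions `g (x, ·)` are locally Lipschitz, locally uniformly with respect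
to `x`: near every point of `Ω` a single Lipschitz constant serves all nearby `x`. -/
def LocLipschitzInSnd (g : ℝ × ℝ → ℝ) (Ω : Set (ℝ × ℝ)) : Prop :=
  ∀ p ∈ Ω, ∃ K : ℝ≥0, ∃ U ∈ 𝓝 p.1, ∃ V ∈ 𝓝 p.2, U ×ˢ V ⊆ Ω ∧
    ∀ x ∈ U, LipschitzOnWith K (fun y => g (x, y)) V

/-- On `Ω`, the functions `g (·, y)` are locally Lipschitz, locally uniformly with respect
to `y`. -/
def LocLipschitzInFst (g : ℝ × ℝ → ℝ) (Ω : Set (ℝ × ℝ)) : Prop :=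
  ∀ p ∈ Ω, ∃ K : ℝ≥0, ∃ U ∈ 𝓝 p.1, ∃ V ∈ 𝓝 p.2, U ×ˢ V ⊆ Ω ∧
    ∀ y ∈ V, LipschitzOnWith K (fun x => g (x, y)) U

/-- `f ∈ C^{1,1}_loc(Ω)` for open `Ω`: `f` is `C¹` with locally Lipschitz differential. -/
def IsC11Loc (f : ℝ × ℝ → ℝ) (Ω : Set (ℝ × ℝ)) : Prop :=
  ContDiffOn ℝ 1 f Ω ∧ LocallyLipschitzOn Ω (fderiv ℝ f)

/-- `g ∈ L^∞_loc(Ω)`: `g` is in `L^∞` of every compact subset of `Ω`. -/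
def MemLinftyLoc (g : ℝ × ℝ → ℝ) (Ω : Set (ℝ × ℝ)) : Prop :=
  ∀ C ⊆ Ω, IsCompact C → MemLp g ∞ (volume.restrict C)

end

/-!
Write `D` for the alternating sum of the values of `f` at the corners of a rectangle. Both Lipschitz
conditions say that `|D| ≤ K |x - x'| |y - y'|` locally: the mean value inequality passes from a
bound on the increments of one first derivative to a bound on `D`, and dividing by the length of the
other side bounds the increments of the other first derivative
(`locLipschitzInFst_pderivSnd`). Exchanging the coordinates gives the converse.

On a small square, `∂₁ f` is then Lipschitz in the second variable, hence differentiable almost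
everywhere on each vertical slice, and Fubini's theorem makes the union of the exceptional sets null
(`volume_ball_inter_not_existsPderivSndAt`). Its derivative is bounded by the Lipschitz constant.
A Lipschitz function is the integral of its derivative, so the integral of `∂₂∂₁ f` over a square is
`D` (`setIntegral_pderivSnd_pderivFst`), and by the exchange of coordinates so is that of `∂₁∂₂ f`.
The squares are the closed balls of the sup distance on `ℝ × ℝ`, so Lebesgue's differentiation
theorem shows that the two mixed derivatives agree almost everywhere
(`ae_eq_of_forall_setIntegral_closedBall_eq`). The step from squares to `Ω` is by locality of null
sets and by compactness.
-/

open Metric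

/-! ### Partial derivatives and exchange of the coordinates -/

theorem hasDerivAt_fst_of_contDiffOn {Ω : Set (ℝ × ℝ)} (hΩ : IsOpen Ω) {f : ℝ × ℝ → ℝ}
    (hf : ContDiffOn ℝ 1 f Ω) {x y : ℝ} (h : (x, y) ∈ Ω) :
    HasDerivAt (fun t => f (t, y)) (fderiv ℝ f (x, y) (1, 0)) x := by
  have h1 : HasFDerivAt f (fderiv ℝ f (x, y)) (x, y) :=
    ((hf.differentiableOn one_ne_zero).differentiableAt (hΩ.mem_nhds h)).hasFDerivAt
  exact h1.comp_hasDerivAt x ((hasDerivAt_id x).prodMk (hasDerivAt_const x y))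

theorem hasDerivAt_snd_of_contDiffOn {Ω : Set (ℝ × ℝ)} (hΩ : IsOpen Ω) {f : ℝ × ℝ → ℝ}
    (hf : ContDiffOn ℝ 1 f Ω) {x y : ℝ} (h : (x, y) ∈ Ω) :
    HasDerivAt (fun t => f (x, t)) (fderiv ℝ f (x, y) (0, 1)) y := by
  have h1 : HasFDerivAt f (fderiv ℝ f (x, y)) (x, y) :=
    ((hf.differentiableOn one_ne_zero).differentiableAt (hΩ.mem_nhds h)).hasFDerivAt
  exact h1.comp_hasDerivAt y ((hasDerivAt_const y x).prodMk (hasDerivAt_id y))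

theorem pderivFst_eq_fderiv {Ω : Set (ℝ × ℝ)} (hΩ : IsOpen Ω) {f : ℝ × ℝ → ℝ}
    (hf : ContDiffOn ℝ 1 f Ω) {p : ℝ × ℝ} (h : p ∈ Ω) :
    pderivFst f p = fderiv ℝ f p (1, 0) :=
  (hasDerivAt_fst_of_contDiffOn hΩ hf h).deriv

theorem pderivSnd_eq_fderiv {Ω : Set (ℝ × ℝ)} (hΩ : IsOpen Ω) {f : ℝ × ℝ → ℝ}
    (hf : ContDiffOn ℝ 1 f Ω) {p : ℝ × ℝ} (h : p ∈ Ω) :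
    pderivSnd f p = fderiv ℝ f p (0, 1) :=
  (hasDerivAt_snd_of_contDiffOn hΩ hf h).deriv

theorem continuousOn_pderivFst {Ω : Set (ℝ × ℝ)} (hΩ : IsOpen Ω) {f : ℝ × ℝ → ℝ}
    (hf : ContDiffOn ℝ 1 f Ω) : ContinuousOn (pderivFst f) Ω :=
  ((hf.continuousOn_fderiv_of_isOpen hΩ le_rfl).clm_apply continuousOn_const).congr
    fun _ hp => pderivFst_eq_fderiv hΩ hf hp

theorem contDiffOn_comp_swap {Ω : Set (ℝ × ℝ)} {f : ℝ × ℝ → ℝ} (hf : ContDiffOn ℝ 1 f Ω) :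
    ContDiffOn ℝ 1 (f ∘ Prod.swap) (Prod.swap ⁻¹' Ω) :=
  hf.comp (contDiff_snd.prodMk contDiff_fst).contDiffOn fun _ h => h

theorem locLipschitzInSnd_comp_swap_iff {g : ℝ × ℝ → ℝ} {Ω : Set (ℝ × ℝ)} :
    LocLipschitzInSnd (g ∘ Prod.swap) (Prod.swap ⁻¹' Ω) ↔ LocLipschitzInFst g Ω := by
  constructor
  · intro h p hp
    obtain ⟨K, U, hU, V, hV, hs, hL⟩ := h p.swap hp
    exact ⟨K, V, hV, U, hU, fun q hq => hs (show q.swap ∈ U ×ˢ V from ⟨hq.2, hq.1⟩), hL⟩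
  · intro h p hp
    obtain ⟨K, U, hU, V, hV, hs, hL⟩ := h p.swap hp
    exact ⟨K, V, hV, U, hU, fun q hq => hs (show q.swap ∈ U ×ˢ V from ⟨hq.2, hq.1⟩), hL⟩

theorem locLipschitzInFst_comp_swap_iff {g : ℝ × ℝ → ℝ} {Ω : Set (ℝ × ℝ)} :
    LocLipschitzInFst (g ∘ Prod.swap) (Prod.swap ⁻¹' Ω) ↔ LocLipschitzInSnd g Ω :=
  (locLipschitzInSnd_comp_swap_iff (g := g ∘ Prod.swap) (Ω := Prod.swap ⁻¹' Ω)).symm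

/-- Local Lipschitz continuity in the second variable, expressed on a square: closed balls for the
sup distance of `ℝ × ℝ` are products of intervals. -/
theorem LocLipschitzInSnd.exists_closedBall {g : ℝ × ℝ → ℝ} {Ω : Set (ℝ × ℝ)}
    (h : LocLipschitzInSnd g Ω) {p : ℝ × ℝ} (hp : p ∈ Ω) :
    ∃ K : ℝ≥0, ∃ r > 0, closedBall p r ⊆ Ω ∧
      ∀ x ∈ closedBall p.1 r, LipschitzOnWith K (fun y => g (x, y)) (closedBall p.2 r) := by
  obtain ⟨K, U, hU, V, hV, hs, hL⟩ := h p hp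
  obtain ⟨r, hr, hrU⟩ := nhds_basis_closedBall.mem_iff.1 hU
  obtain ⟨s, hs0, hsV⟩ := nhds_basis_closedBall.mem_iff.1 hV
  have hU' := (closedBall_subset_closedBall (min_le_left r s)).trans hrU
  have hV' := (closedBall_subset_closedBall (min_le_right r s)).trans hsV
  refine ⟨K, min r s, lt_min hr hs0, ?_, fun x hx => (hL x (hU' hx)).mono hV'⟩
  rw [← Prod.mk.eta (p := p), ← closedBall_prod_same]
  exact (prod_mono hU' hV').trans hs

/-! ### The two Lipschitz conditions -/

/-- The increment `f (x', ·) - f (x, ·)` has Lipschitz constant `K |x - x'|`, because its own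
increments are those of `t ↦ f (t, y') - f (t, y)`, whose derivative is at most `K |y - y'|`.
Hence its derivative is at most `K |x - x'|`. -/
theorem locLipschitzInFst_pderivSnd {Ω : Set (ℝ × ℝ)} (hΩ : IsOpen Ω) {f : ℝ × ℝ → ℝ}
    (hf : ContDiffOn ℝ 1 f Ω) (h : LocLipschitzInSnd (pderivFst f) Ω) :
    LocLipschitzInFst (pderivSnd f) Ω := by
  intro p hp
  obtain ⟨K, r, hr, hsub, hL⟩ := h.exists_closedBall hp
  have hmem : ∀ {x y}, x ∈ ball p.1 r → y ∈ ball p.2 r → (x, y) ∈ Ω := fun hx hy =>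
    hsub (closedBall_prod_same p.1 p.2 r ▸
      mk_mem_prod (ball_subset_closedBall hx) (ball_subset_closedBall hy))
  refine ⟨K, ball p.1 r, ball_mem_nhds _ hr, ball p.2 r, ball_mem_nhds _ hr,
    fun q hq => hmem hq.1 hq.2, fun y hy => LipschitzOnWith.of_dist_le_mul fun x hx x' hx' => ?_⟩
  have key : LipschitzOnWith (K * nndist x x') (fun t => f (x, t) - f (x', t)) (ball p.2 r) := by
    refine LipschitzOnWith.of_dist_le_mul fun s hs t ht => ?_
    have hd : ∀ u ∈ ball p.1 r, HasDerivWithinAt (fun u => f (u, s) - f (u, t))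
        (pderivFst f (u, s) - pderivFst f (u, t)) (ball p.1 r) u := fun u hu => by
      rw [pderivFst_eq_fderiv hΩ hf (hmem hu hs), pderivFst_eq_fderiv hΩ hf (hmem hu ht)]
      exact ((hasDerivAt_fst_of_contDiffOn hΩ hf (hmem hu hs)).sub
        (hasDerivAt_fst_of_contDiffOn hΩ hf (hmem hu ht))).hasDerivWithinAt
    have hb : ∀ u ∈ ball p.1 r, ‖pderivFst f (u, s) - pderivFst f (u, t)‖ ≤ K * dist s t :=
      fun u hu => by
        simpa [dist_eq_norm] using (hL u (ball_subset_closedBall hu)).dist_le_mul s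
          (ball_subset_closedBall hs) t (ball_subset_closedBall ht)
    have := (convex_ball p.1 r).norm_image_sub_le_of_norm_hasDerivWithin_le hd hb hx' hx
    rw [dist_eq_norm, NNReal.coe_mul, coe_nndist, dist_eq_norm x x']
    calc ‖f (x, s) - f (x', s) - (f (x, t) - f (x', t))‖
        = ‖f (x, s) - f (x, t) - (f (x', s) - f (x', t))‖ := by congr 1; ring
      _ ≤ K * dist s t * ‖x - x'‖ := this
      _ = _ := by ring
  have hder : deriv (fun t => f (x, t) - f (x', t)) y = pderivSnd f (x, y) - pderivSnd f (x', y) := by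
    rw [pderivSnd_eq_fderiv hΩ hf (hmem hx hy), pderivSnd_eq_fderiv hΩ hf (hmem hx' hy)]
    exact ((hasDerivAt_snd_of_contDiffOn hΩ hf (hmem hx hy)).sub
      (hasDerivAt_snd_of_contDiffOn hΩ hf (hmem hx' hy))).deriv
  have := norm_deriv_le_of_lipschitzOn (isOpen_ball.mem_nhds hy) key
  rw [hder] at this
  simpa [dist_eq_norm] using this

theorem locLipschitzInSnd_pderivFst_iff {Ω : Set (ℝ × ℝ)} (hΩ : IsOpen Ω) {f : ℝ × ℝ → ℝ}
    (hf : ContDiffOn ℝ 1 f Ω) :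
    LocLipschitzInSnd (pderivFst f) Ω ↔ LocLipschitzInFst (pderivSnd f) Ω :=
  ⟨locLipschitzInFst_pderivSnd hΩ hf, fun h =>
    locLipschitzInFst_comp_swap_iff.1 <|
      locLipschitzInFst_pderivSnd (hΩ.preimage continuous_swap) (contDiffOn_comp_swap hf)
        (locLipschitzInSnd_comp_swap_iff.2 h)⟩

theorem IsC11Loc.locLipschitzInSnd_pderivFst {Ω : Set (ℝ × ℝ)} (hΩ : IsOpen Ω) {f : ℝ × ℝ → ℝ}
    (h : IsC11Loc f Ω) : LocLipschitzInSnd (pderivFst f) Ω := by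
  intro p hp
  obtain ⟨K, t, ht, hL⟩ := h.2 hp
  rw [hΩ.nhdsWithin_eq hp] at ht
  obtain ⟨U, hU, V, hV, hUV⟩ := mem_nhds_prod_iff.1 (inter_mem ht (hΩ.mem_nhds hp))
  refine ⟨K, U, hU, V, hV, fun q hq => (hUV hq).2, fun x hx =>
    LipschitzOnWith.of_dist_le_mul fun y hy y' hy' => ?_⟩
  have h1 := hUV (mk_mem_prod hx hy)
  have h2 := hUV (mk_mem_prod hx hy')
  have h3 := hL.dist_le_mul _ h1.1 _ h2.1
  simp only [pderivFst_eq_fderiv hΩ h.1 h1.2, pderivFst_eq_fderiv hΩ h.1 h2.2]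
  rw [Prod.dist_eq, dist_self, max_eq_right dist_nonneg, dist_eq_norm] at h3
  rw [dist_eq_norm, ← sub_apply]
  -- `(1, 0)` has norm one, so evaluation at it does not increase norms.
  exact ((ContinuousLinearMap.le_opNorm _ _).trans (by simp)).trans h3

/-! ### The second variable derivative on a square -/

theorem exists_continuous_eqOn_of_isClosed {X : Type*} [TopologicalSpace X] [NormalSpace X]
    {s : Set X} (hs : IsClosed s) {g : X → ℝ} (hg : ContinuousOn g s) :
    ∃ G : X → ℝ, Continuous G ∧ EqOn G g s := by
  obtain ⟨G, hG⟩ := ContinuousMap.exists_restrict_eq hs ⟨s.domRestrict g, hg.domRestrict⟩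
  exact ⟨G, G.continuous, fun x hx => congrArg (fun F : C(s, ℝ) => F ⟨x, hx⟩) hG⟩

theorem Set.EqOn.eventuallyEq_snd {G g : ℝ × ℝ → ℝ} {s : Set (ℝ × ℝ)} (h : EqOn G g s)
    {q : ℝ × ℝ} (hq : s ∈ 𝓝 q) : (fun y => G (q.1, y)) =ᶠ[𝓝 q.2] fun y => g (q.1, y) := by
  have hc : ContinuousAt (fun y => (q.1, y)) q.2 := by fun_prop
  filter_upwards [hc.preimage_mem_nhds hq] with y hy using h hy

theorem aestronglyMeasurable_pderivSnd {g : ℝ × ℝ → ℝ} {p : ℝ × ℝ} {r : ℝ}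
    (hg : ContinuousOn g (closedBall p r)) :
    AEStronglyMeasurable (pderivSnd g) (volume.restrict (ball p r)) := by
  obtain ⟨G, hG, hGg⟩ := exists_continuous_eqOn_of_isClosed isClosed_closedBall hg
  have hm : Measurable (pderivSnd G) :=
    measurable_deriv_with_param (f := fun x y => G (x, y)) hG
  refine hm.aestronglyMeasurable.congr ?_
  filter_upwards [ae_restrict_mem measurableSet_ball] with q hq
  exact (hGg.eventuallyEq_snd (closedBall_mem_nhds_of_mem hq)).deriv_eq

/-- On a square, a continuous function that is Lipschitz in the second variable has a second
partial derivative almost everywhere. The continuous extension makes the exceptional set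
measurable, so that it suffices to apply Rademacher's theorem on each vertical slice. -/
theorem volume_ball_inter_not_existsPderivSndAt {g : ℝ × ℝ → ℝ} {p : ℝ × ℝ} {r : ℝ} {K : ℝ≥0}
    (hg : ContinuousOn g (closedBall p r))
    (hL : ∀ x ∈ closedBall p.1 r, LipschitzOnWith K (fun y => g (x, y)) (closedBall p.2 r)) :
    volume (ball p r ∩ {q | ¬ ExistsPderivSndAt g q}) = 0 := by
  obtain ⟨G, hG, hGg⟩ := exists_continuous_eqOn_of_isClosed isClosed_closedBall hg
  have hiff : ∀ q ∈ ball p r,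
      (DifferentiableAt ℝ (fun y => G (q.1, y)) q.2 ↔ ExistsPderivSndAt g q) := fun q hq =>
    (hGg.eventuallyEq_snd (closedBall_mem_nhds_of_mem hq)).differentiableAt_iff
  have hset : ball p r ∩ {q | ¬ ExistsPderivSndAt g q} =
      ball p r ∩ {q | DifferentiableAt ℝ (fun y => G (q.1, y)) q.2}ᶜ := by
    ext q
    exact and_congr_right fun hq => not_congr (hiff q hq).symm
  have hmeas : MeasurableSet (ball p r ∩ {q | ¬ ExistsPderivSndAt g q}) := by
    rw [hset]
    exact measurableSet_ball.inter
      (measurableSet_of_differentiableAt_with_param ℝ (f := fun x y => G (x, y)) hG).compl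
  rw [Measure.volume_eq_prod, Measure.measure_prod_null hmeas]
  refine Eventually.of_forall fun x => ?_
  by_cases hx : x ∈ ball p.1 r
  · refine measure_mono_null ?_
      (ae_iff.1 (hL x (ball_subset_closedBall hx)).ae_differentiableWithinAt_of_mem_real)
    rintro y ⟨hy, hn⟩ hd
    rw [← Prod.mk.eta (p := p), ← ball_prod_same] at hy
    exact hn ((hd (ball_subset_closedBall hy.2)).differentiableAt
      (closedBall_mem_nhds_of_mem hy.2))
  · refine measure_mono_null (t := ∅) ?_ measure_empty
    rintro y ⟨hy, -⟩
    rw [← Prod.mk.eta (p := p), ← ball_prod_same] at hy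
    exact hx hy.1

theorem norm_pderivSnd_le {g : ℝ × ℝ → ℝ} {p : ℝ × ℝ} {r : ℝ} {K : ℝ≥0}
    (hL : ∀ x ∈ closedBall p.1 r, LipschitzOnWith K (fun y => g (x, y)) (closedBall p.2 r))
    {q : ℝ × ℝ} (hq : q ∈ ball p r) : ‖pderivSnd g q‖ ≤ K := by
  rw [← Prod.mk.eta (p := p), ← ball_prod_same] at hq
  exact norm_deriv_le_of_lipschitzOn (closedBall_mem_nhds_of_mem hq.2)
    (hL q.1 (ball_subset_closedBall hq.1))

theorem integrableOn_pderivSnd {g : ℝ × ℝ → ℝ} {p : ℝ × ℝ} {r : ℝ} {K : ℝ≥0}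
    (hg : ContinuousOn g (closedBall p r))
    (hL : ∀ x ∈ closedBall p.1 r, LipschitzOnWith K (fun y => g (x, y)) (closedBall p.2 r)) :
    IntegrableOn (pderivSnd g) (ball p r) :=
  haveI : IsFiniteMeasure (volume.restrict (ball p r)) := ⟨by
    rw [Measure.restrict_apply_univ]
    exact measure_ball_lt_top⟩
  Integrable.of_bound (aestronglyMeasurable_pderivSnd hg) K <| by
    filter_upwards [ae_restrict_mem measurableSet_ball] with q hq using norm_pderivSnd_le hL hq

/-- The integral of `∂₂∂₁ f` over a square is the alternating sum of the values of `f` at the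
corners: integrate first in the second variable, where `∂₁ f` is absolutely continuous. -/
theorem setIntegral_pderivSnd_pderivFst {Ω : Set (ℝ × ℝ)} (hΩ : IsOpen Ω) {f : ℝ × ℝ → ℝ}
    (hf : ContDiffOn ℝ 1 f Ω) {p : ℝ × ℝ} {r : ℝ} {K : ℝ≥0} (hsub : closedBall p r ⊆ Ω)
    (hL : ∀ x ∈ closedBall p.1 r,
      LipschitzOnWith K (fun y => pderivFst f (x, y)) (closedBall p.2 r))
    {a b s : ℝ} (hs : 0 ≤ s) (hq : closedBall (a, b) s ⊆ ball p r) :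
    ∫ q in closedBall (a, b) s, pderivSnd (pderivFst f) q =
      f (a + s, b + s) - f (a - s, b + s) - (f (a + s, b - s) - f (a - s, b - s)) := by
  have hcont := (continuousOn_pderivFst hΩ hf).mono hsub
  have hint := (integrableOn_pderivSnd hcont hL).mono_set hq
  have hmem : ∀ {x y}, x ∈ Icc (a - s) (a + s) → y ∈ Icc (b - s) (b + s) →
      (x, y) ∈ ball p r := fun hx hy => hq <| by
    rw [← closedBall_prod_same, Real.closedBall_eq_Icc, Real.closedBall_eq_Icc]
    exact ⟨hx, hy⟩
  have hmem' : ∀ {x y}, x ∈ Icc (a - s) (a + s) → y ∈ Icc (b - s) (b + s) →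
      x ∈ closedBall p.1 r ∧ y ∈ closedBall p.2 r := fun hx hy => by
    have := hmem hx hy
    rw [← Prod.mk.eta (p := p), ← ball_prod_same] at this
    exact ⟨ball_subset_closedBall this.1, ball_subset_closedBall this.2⟩
  have ha : a - s ≤ a + s := by linarith
  have hb : b - s ≤ b + s := by linarith
  have inner : ∀ x ∈ Icc (a - s) (a + s),
      ∫ y in Icc (b - s) (b + s), pderivSnd (pderivFst f) (x, y) =
        pderivFst f (x, b + s) - pderivFst f (x, b - s) := fun x hx => by
    rw [integral_Icc_eq_integral_Ioc, ← intervalIntegral.integral_of_le hb]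
    refine AbsolutelyContinuousOnInterval.integral_deriv_eq_sub
      (f := fun y => pderivFst f (x, y)) ?_
    refine LipschitzOnWith.absolutelyContinuousOnInterval (K := K) ?_
    rw [uIcc_of_le hb]
    exact (hL x (hmem' hx (left_mem_Icc.2 hb)).1).mono fun y hy => (hmem' hx hy).2
  have outer : ∀ y ∈ Icc (b - s) (b + s),
      IntervalIntegrable (fun x => pderivFst f (x, y)) volume (a - s) (a + s) ∧
      ∫ x in (a - s)..(a + s), pderivFst f (x, y) = f (a + s, y) - f (a - s, y) := fun y hy => by
    have hi : IntervalIntegrable (fun x => pderivFst f (x, y)) volume (a - s) (a + s) := by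
      refine ContinuousOn.intervalIntegrable ?_
      rw [uIcc_of_le ha]
      exact hcont.comp (by fun_prop) fun x hx => ball_subset_closedBall (hmem hx hy)
    refine ⟨hi, intervalIntegral.integral_eq_sub_of_hasDerivAt (f := fun x => f (x, y))
      (fun x hx => ?_) hi⟩
    rw [uIcc_of_le ha] at hx
    have hΩx := hsub (ball_subset_closedBall (hmem hx hy))
    rw [pderivFst_eq_fderiv hΩ hf hΩx]
    exact hasDerivAt_fst_of_contDiffOn hΩ hf hΩx
  rw [← closedBall_prod_same, Real.closedBall_eq_Icc, Real.closedBall_eq_Icc] at hint ⊢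
  rw [Measure.volume_eq_prod] at hint ⊢
  rw [setIntegral_prod _ hint, setIntegral_congr_fun measurableSet_Icc inner,
    integral_Icc_eq_integral_Ioc, ← intervalIntegral.integral_of_le ha,
    intervalIntegral.integral_sub (outer _ (right_mem_Icc.2 hb)).1 (outer _ (left_mem_Icc.2 hb)).1,
    (outer _ (right_mem_Icc.2 hb)).2, (outer _ (left_mem_Icc.2 hb)).2]

/-! ### Equality of functions with equal integrals over squares -/

/-- By Lebesgue's differentiation theorem, two integrable functions with the same integral over
every small closed ball agree almost everywhere. -/
theorem ae_eq_of_forall_setIntegral_closedBall_eq {u v : ℝ × ℝ → ℝ} {p : ℝ × ℝ} {r : ℝ}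
    (hu : IntegrableOn u (ball p r)) (hv : IntegrableOn v (ball p r))
    (h : ∀ q s, 0 ≤ s → closedBall q s ⊆ ball p r →
      ∫ z in closedBall q s, u z = ∫ z in closedBall q s, v z) :
    ∀ᵐ q, q ∈ ball p r → u q = v q := by
  have hu' := (hu.integrable_indicator measurableSet_ball).locallyIntegrable
  have hv' := (hv.integrable_indicator measurableSet_ball).locallyIntegrable
  filter_upwards [IsUnifLocDoublingMeasure.ae_tendsto_average volume hu' 1,
    IsUnifLocDoublingMeasure.ae_tendsto_average volume hv' 1] with q hqu hqv hq
  have hball : ∀ᶠ s : ℝ in 𝓝[>] 0, q ∈ closedBall q (1 * s) := by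
    filter_upwards [self_mem_nhdsWithin] with s hs
    exact mem_closedBall_self (by simpa using le_of_lt hs)
  have tu := hqu (fun _ => q) (fun s => s) tendsto_id hball
  have tv := hqv (fun _ => q) (fun s => s) tendsto_id hball
  rw [indicator_of_mem hq] at tu tv
  refine tendsto_nhds_unique_of_eventuallyEq tu tv ?_
  have hsmall : ∀ᶠ s : ℝ in 𝓝[>] 0, closedBall q s ⊆ ball p r :=
    nhdsWithin_le_nhds (eventually_closedBall_subset (isOpen_ball.mem_nhds hq))
  filter_upwards [self_mem_nhdsWithin, hsmall] with s hs hsub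
  have e : ∀ w : ℝ × ℝ → ℝ, ∫ z in closedBall q s, (ball p r).indicator w z =
      ∫ z in closedBall q s, w z := fun w =>
    setIntegral_congr_fun measurableSet_closedBall fun z hz => indicator_of_mem (hsub hz) w
  rw [setAverage_eq, setAverage_eq, e, e, h q s (le_of_lt hs) hsub]

/-! ### The mixed derivatives -/

theorem volume_preimage_swap_eq_zero {s : Set (ℝ × ℝ)} (h : volume s = 0) :
    volume (Prod.swap ⁻¹' s) = 0 :=
  (Measure.measurePreserving_swap (μ := (volume : Measure ℝ))
    (ν := (volume : Measure ℝ))).quasiMeasurePreserving.preimage_null h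

theorem preimage_swap_closedBall (p : ℝ × ℝ) (r : ℝ) :
    Prod.swap ⁻¹' closedBall p r = closedBall p.swap r := by
  ext q
  simp [Prod.dist_eq, max_comm]

theorem preimage_swap_ball (p : ℝ × ℝ) (r : ℝ) :
    Prod.swap ⁻¹' ball p r = ball p.swap r := by
  ext q
  simp [Prod.dist_eq, and_comm]

theorem setIntegral_closedBall_comp_swap (w : ℝ × ℝ → ℝ) (q : ℝ × ℝ) (s : ℝ) :
    ∫ z in closedBall q.swap s, w z.swap = ∫ z in closedBall q s, w z := by
  rw [← preimage_swap_closedBall]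
  exact (Measure.measurePreserving_swap (μ := (volume : Measure ℝ))
    (ν := (volume : Measure ℝ))).setIntegral_preimage_emb
      MeasurableEquiv.prodComm.measurableEmbedding w _

theorem LocLipschitzInSnd.volume_not_existsPderivSndAt {Ω : Set (ℝ × ℝ)} {g : ℝ × ℝ → ℝ}
    (hg : ContinuousOn g Ω) (h : LocLipschitzInSnd g Ω) :
    volume (Ω ∩ {q | ¬ ExistsPderivSndAt g q}) = 0 := by
  refine measure_null_of_locally_null _ fun p hp => ?_
  obtain ⟨K, r, hr, hsub, hL⟩ := h.exists_closedBall hp.1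
  exact ⟨_, inter_mem (mem_nhdsWithin_of_mem_nhds (ball_mem_nhds p hr))
    (mem_of_superset self_mem_nhdsWithin inter_subset_right),
    volume_ball_inter_not_existsPderivSndAt (hg.mono hsub) hL⟩

theorem memLinftyLoc_of_locally {g : ℝ × ℝ → ℝ} {Ω : Set (ℝ × ℝ)}
    (h : ∀ p ∈ Ω, ∃ t ∈ 𝓝 p, AEStronglyMeasurable g (volume.restrict t) ∧
      ∃ K : ℝ, ∀ q ∈ t, ‖g q‖ ≤ K) : MemLinftyLoc g Ω := by
  intro C hC hCc
  have key : AEStronglyMeasurable g (volume.restrict C) ∧ ∃ K : ℝ, ∀ q ∈ C, ‖g q‖ ≤ K := by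
    refine hCc.induction_on (p := fun t => AEStronglyMeasurable g (volume.restrict t) ∧
      ∃ K : ℝ, ∀ q ∈ t, ‖g q‖ ≤ K) (by simp) ?_ ?_ fun p hp => ?_
    · rintro s t hst ⟨h1, K, h2⟩
      exact ⟨h1.mono_set hst, K, fun q hq => h2 q (hst hq)⟩
    · rintro s t ⟨h1, K, h2⟩ ⟨h1', K', h2'⟩
      refine ⟨aestronglyMeasurable_union_iff.2 ⟨h1, h1'⟩, max K K', ?_⟩
      rintro q (hq | hq)
      · exact (h2 q hq).trans (le_max_left _ _)
      · exact (h2' q hq).trans (le_max_right _ _)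
    · obtain ⟨t, ht, H⟩ := h p (hC hp)
      exact ⟨t, mem_nhdsWithin_of_mem_nhds ht, H⟩
  obtain ⟨hm, K, hK⟩ := key
  exact memLp_top_of_bound hm K (ae_restrict_of_forall_mem hCc.measurableSet hK)

theorem LocLipschitzInSnd.memLinftyLoc_pderivSnd {Ω : Set (ℝ × ℝ)} {g : ℝ × ℝ → ℝ}
    (hg : ContinuousOn g Ω) (h : LocLipschitzInSnd g Ω) : MemLinftyLoc (pderivSnd g) Ω := by
  refine memLinftyLoc_of_locally fun p hp => ?_
  obtain ⟨K, r, hr, hsub, hL⟩ := h.exists_closedBall hp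
  exact ⟨ball p r, ball_mem_nhds p hr, aestronglyMeasurable_pderivSnd (hg.mono hsub), K,
    fun q hq => norm_pderivSnd_le hL hq⟩

theorem memLinftyLoc_of_comp_swap {Ω : Set (ℝ × ℝ)} {g : ℝ × ℝ → ℝ}
    (h : MemLinftyLoc (g ∘ Prod.swap) (Prod.swap ⁻¹' Ω)) : MemLinftyLoc g Ω := by
  intro C hC hCc
  have hmp := (Measure.measurePreserving_swap (μ := (volume : Measure ℝ))
    (ν := (volume : Measure ℝ))).restrict_preimage
      (hCc.measurableSet.preimage measurable_swap)
  exact (h (Prod.swap ⁻¹' C) (preimage_mono hC)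
    ((Homeomorph.prodComm ℝ ℝ).isCompact_preimage.2 hCc)).comp_measurePreserving hmp

/-- Both mixed derivatives have the same integral over every small square, namely the alternating
sum of the values of `f` at the corners. -/
theorem volume_pderivSnd_pderivFst_ne {Ω : Set (ℝ × ℝ)} (hΩ : IsOpen Ω) {f : ℝ × ℝ → ℝ}
    (hf : ContDiffOn ℝ 1 f Ω) (h : LocLipschitzInSnd (pderivFst f) Ω) :
    volume (Ω ∩ {q | pderivSnd (pderivFst f) q ≠ pderivFst (pderivSnd f) q}) = 0 := by
  have h' : LocLipschitzInSnd (pderivFst (f ∘ Prod.swap)) (Prod.swap ⁻¹' Ω) :=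
    locLipschitzInSnd_comp_swap_iff.2 (locLipschitzInFst_pderivSnd hΩ hf h)
  have hΩ' : IsOpen (Prod.swap ⁻¹' Ω : Set (ℝ × ℝ)) := hΩ.preimage continuous_swap
  have hf' := contDiffOn_comp_swap hf
  refine measure_null_of_locally_null _ fun p hp => ?_
  obtain ⟨K, r, hr, hsub, hL⟩ := h.exists_closedBall hp.1
  obtain ⟨K', r', hr', hsub', hL'⟩ := h'.exists_closedBall (p := p.swap) hp.1
  have hu := (integrableOn_pderivSnd ((continuousOn_pderivFst hΩ hf).mono hsub) hL).mono_set
    (ball_subset_ball (min_le_left r r'))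
  have hv' := (integrableOn_pderivSnd ((continuousOn_pderivFst hΩ' hf').mono hsub') hL').mono_set
    (ball_subset_ball (min_le_right r r'))
  have hv : IntegrableOn (pderivFst (pderivSnd f)) (ball p (min r r')) := by
    rw [← preimage_swap_ball] at hv'
    exact ((Measure.measurePreserving_swap (μ := (volume : Measure ℝ))
      (ν := (volume : Measure ℝ))).integrableOn_comp_preimage
        MeasurableEquiv.prodComm.measurableEmbedding).1 hv'
  have hae := ae_eq_of_forall_setIntegral_closedBall_eq hu hv fun q s hs hq => by
    have hq' : closedBall q.swap s ⊆ ball p.swap (min r r') := by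
      rw [← preimage_swap_closedBall, ← preimage_swap_ball]
      exact preimage_mono hq
    have e1 := setIntegral_pderivSnd_pderivFst hΩ hf hsub hL (a := q.1) (b := q.2) hs
      (hq.trans (ball_subset_ball (min_le_left r r')))
    have e2 := setIntegral_pderivSnd_pderivFst hΩ' hf' hsub' hL' (a := q.2) (b := q.1) hs
      (hq'.trans (ball_subset_ball (min_le_right r r')))
    have e3 := setIntegral_closedBall_comp_swap (pderivFst (pderivSnd f)) q s
    rw [← e3]
    refine e1.trans (Eq.trans ?_ e2.symm)
    simp only [Function.comp_apply, Prod.swap_prod_mk]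
    ring
  refine ⟨_, inter_mem (mem_nhdsWithin_of_mem_nhds (ball_mem_nhds p (lt_min hr hr')))
    (mem_of_superset self_mem_nhdsWithin inter_subset_right), measure_mono_null ?_ (ae_iff.1 hae)⟩
  exact fun q hq hn => hq.2 (hn hq.1)

theorem mainTheorem1 (Ω : Set (ℝ × ℝ)) (hΩ : IsOpen Ω) (f : ℝ × ℝ → ℝ)
    (hf : ContDiffOn ℝ 1 f Ω) :
    (LocLipschitzInSnd (pderivFst f) Ω ↔ LocLipschitzInFst (pderivSnd f) Ω) ∧
    (IsC11Loc f Ω →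
      LocLipschitzInSnd (pderivFst f) Ω ∧ LocLipschitzInFst (pderivSnd f) Ω) ∧
    (LocLipschitzInSnd (pderivFst f) Ω →
      (∃ E ⊆ Ω, volume (Ω \ E) = 0 ∧ ∀ p ∈ E,
        DifferentiableAt ℝ f p ∧
        ExistsPderivSndAt (pderivFst f) p ∧
        ExistsPderivFstAt (pderivSnd f) p ∧
        pderivSnd (pderivFst f) p = pderivFst (pderivSnd f) p) ∧
      MemLinftyLoc (pderivSnd (pderivFst f)) Ω ∧
      MemLinftyLoc (pderivFst (pderivSnd f)) Ω) := by
  have hiff := locLipschitzInSnd_pderivFst_iff hΩ hf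
  refine ⟨hiff, fun h => ?_, fun h => ?_⟩
  · have h1 := h.locLipschitzInSnd_pderivFst hΩ
    exact ⟨h1, hiff.1 h1⟩
  have hc := continuousOn_pderivFst hΩ hf
  have hc' := continuousOn_pderivFst (hΩ.preimage continuous_swap) (contDiffOn_comp_swap hf)
  have h' : LocLipschitzInSnd (pderivFst (f ∘ Prod.swap)) (Prod.swap ⁻¹' Ω) :=
    locLipschitzInSnd_comp_swap_iff.2 (hiff.1 h)
  refine ⟨⟨{p ∈ Ω | ExistsPderivSndAt (pderivFst f) p ∧ ExistsPderivFstAt (pderivSnd f) p ∧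
      pderivSnd (pderivFst f) p = pderivFst (pderivSnd f) p}, fun p hp => hp.1, ?_,
      fun p hp => ⟨(hf.differentiableOn one_ne_zero).differentiableAt (hΩ.mem_nhds hp.1), hp.2⟩⟩,
    h.memLinftyLoc_pderivSnd hc, memLinftyLoc_of_comp_swap (h'.memLinftyLoc_pderivSnd hc')⟩
  refine measure_mono_null (fun p hp => ?_) (measure_union_null (measure_union_null
    (h.volume_not_existsPderivSndAt hc)
    (volume_preimage_swap_eq_zero (h'.volume_not_existsPderivSndAt hc')))
    (volume_pderivSnd_pderivFst_ne hΩ hf h))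
  by_contra hn
  simp only [mem_union, not_or] at hn
  exact hp.2 ⟨hp.1, by_contra fun c => hn.1.1 ⟨hp.1, c⟩, by_contra fun c => hn.1.2 ⟨hp.1, c⟩,
    by_contra fun c => hn.2 ⟨hp.1, c⟩⟩
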